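/- All logarithms are binary, and $\log^*\ell$ denotes the iterated logarithm of $\ell$, i.e. the number of times $\log$ has to be applied to $\ell$ before the result is at most $1$. For a family $\mathcal{H}$ of subsets of a finite set $X$, let $\langle\mathcal{H}\rangle := \{A\subseteq X : A\supseteq S \text{ for some } S\in\mathcal{H}\}$ be its up-set. The family $\mathcal{H}$ is $\ell$-bounded if each of its members has at most $\ell$ elements, and $\mathsf{VC}(\mathcal{H})$ is the largest size of a set $T\subseteq X$ such that every $A\subseteq T$ is of the form $A=T\cap S$ with $S\in\mathcal{H}$ (with $\mathsf{VC}(\emptyset):=0$). For $p\ge 0$, let $X_p$ be the distribution of the random subset of $X$ that contains each element of $X$ independently with probability $\min(p,1)$. **Theorem** (Kahn–Kalai for set families of bounded VC-dimension). There is a universal constant $A>0$ with the following property. Let $X$ be a finite set, let $\ell\ge 0$ and $d\ge 1$ be integers, let $\mathcal{H}$ be an $\ell$-bounded family of subsets of $X$ with $\mathsf{VC}(\mathcal{H})\le d$, and let $q\in[0,1]$. Then at least one of the following statements holds. 1. There is a family $\mathcal{F}$ of subsets of $X$ with $\mathcal{H}\subseteq\langle\mathcal{F}\rangle$ and $\sum_{F\in\mathcal{F}}q^{|F|}\le\frac{2}{3}$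 (where $0^0=1$). 2. For all $\varepsilon\in(0,\frac12]$, if $p=A\,q\,(\log(d/\varepsilon)+\log^*\ell)$ and $W\sim X_p$, then $\mathbb{P}[W\in\langle\mathcal{H}\rangle]>1-\varepsilon$. -/

import Mathlib

/-- The up-set generated by a set system `H` on the ground set `X`: all subsets of `X` that
contain some member of `H`. -/
def upSet {X : Type*} (H : Finset (Finset X)) : Set (Set X) :=
  {A | ∃ S ∈ H, (S : Set X) ⊆ A}

/-- `H` is `l`-bounded if all of its members have size at most `l`. -/
def IsBoundedSystem {X : Type*} (l : ℕ) (H : Finset (Finset X)) : Prop :=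
  ∀ S ∈ H, S.card ≤ l

/-- The distribution of a random subset of `X` that contains each element independently with
probability `p`; values `p > 1` are read as `p = 1` (and `p < 0`, which is never used, as
`p = 0`). -/
noncomputable def randomSubset (X : Type*) (p : ℝ) : MeasureTheory.Measure (Set X) :=
  ProbabilityTheory.setBernoulli Set.univ (Set.projIcc (0 : ℝ) 1 zero_le_one p)

/-- The iterated logarithm: the number of times the binary logarithm has to be applied to `x`
before the result is at most `1`. -/
noncomputable def logStar (x : ℝ) : ℕ :=
  sInf {k : ℕ | (Real.logb 2)^[k] x ≤ 1}

/-- The set whose least element defines `logStar` is nonempty. -/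
theorem logStar_set_nonempty (x : ℝ) : {k : ℕ | (Real.logb 2)^[k] x ≤ 1}.Nonempty := by
  obtain ⟨n, hn⟩ := exists_nat_ge x
  induction n generalizing x with
  | zero => exact ⟨0, by simpa using hn.trans (by norm_num)⟩
  | succ n ih =>
    by_cases hx : x ≤ 1
    · exact ⟨0, by simpa using hx⟩
    push Not at hx
    by_cases h2 : x ≤ 2
    · refine ⟨1, ?_⟩
      have h := Real.logb_le_logb_of_le (b := 2) (by norm_num) (by linarith) h2
      simpa using h
    push Not at h2
    have hlog : Real.logb 2 x ≤ n := by
      have h1 : x ≤ (2 : ℝ) ^ n := by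
        have h3 : n + 1 ≤ 2 ^ n := Nat.lt_two_pow_self
        have h4 : ((n + 1 : ℕ) : ℝ) ≤ ((2 ^ n : ℕ) : ℝ) := by exact_mod_cast h3
        push_cast at h4 hn
        linarith
      have h := Real.logb_le_logb_of_le (b := 2) (by norm_num) (by linarith) h1
      simpa [Real.logb_pow] using h
    obtain ⟨k, hk⟩ := ih (Real.logb 2 x) hlog
    exact ⟨k + 1, by simpa [Function.iterate_succ_apply] using hk⟩

/-! The random set is exposed in slices `W` of density `64 * q`. Relative to a slice, each `S` in
`H` contains either a fragment `R \ W` (`R` in `H`) of size at most `m`, or a heavy trace `U`: more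
than `m` elements, cut out of `S` by a member of `H` that depends on `W ∪ U` alone
(`exists_lightFragment_or_heavyTrace`). By Sauer-Shelah each union admits few traces, so on average
the heavy ones cost little (`sampleExp_heavyCover_le`). Hence with probability at least 3/4 the
fragments still have no cheap cover, and their VC-dimension has not grown; otherwise the slice is
wasted and `H` is kept (`MissBound.succ`). A good slice turns a size bound `16 d² x` into `16 d² log
x`. About `log* l` of them reach order `d²`, then `O(log d)` halvings reach the empty set; some `log
(1/ε)` extra slices make failure unlikely. -/

open Finset

/-! ### Expectations over random subsets. -/

/-- The expectation of `f W`, where `W` is a random subset of `s` that contains each element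
independently with probability `p`. -/
noncomputable def sampleExp {X : Type*} [DecidableEq X] (p : ℝ) (s : Finset X)
    (f : Finset X → ℝ) : ℝ :=
  ∑ W ∈ s.powerset, p ^ #W * (1 - p) ^ #(s \ W) * f W

namespace sampleExp

variable {X : Type*} [DecidableEq X]

theorem insert_eq (p : ℝ) {s : Finset X} {a : X} (ha : a ∉ s) (f : Finset X → ℝ) :
    sampleExp p (insert a s) f =
      (1 - p) * sampleExp p s f + p * sampleExp p s (fun W => f (insert a W)) := by
  unfold sampleExp
  rw [sum_powerset_insert ha, mul_sum, mul_sum]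
  congr 1 <;> refine sum_congr rfl fun W hW => ?_
  · have haW : a ∉ W := fun h => ha (mem_powerset.1 hW h)
    rw [insert_sdiff_of_notMem _ haW, card_insert_of_notMem (by simp [ha])]
    ring
  · have haW : a ∉ W := fun h => ha (mem_powerset.1 hW h)
    rw [insert_sdiff_insert, sdiff_insert_of_notMem ha, card_insert_of_notMem haW]
    ring

theorem mono {p : ℝ} (h0 : 0 ≤ p) (h1 : p ≤ 1) (s : Finset X) {f g : Finset X → ℝ}
    (h : ∀ W, f W ≤ g W) : sampleExp p s f ≤ sampleExp p s g := by
  have := sub_nonneg.2 h1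
  exact sum_le_sum fun W _ => mul_le_mul_of_nonneg_left (h W) (by positivity)

theorem add (p : ℝ) (s : Finset X) (f g : Finset X → ℝ) :
    sampleExp p s (fun W => f W + g W) = sampleExp p s f + sampleExp p s g := by
  simp [sampleExp, mul_add, sum_add_distrib]

theorem mul_left (p c : ℝ) (s : Finset X) (f : Finset X → ℝ) :
    sampleExp p s (fun W => c * f W) = c * sampleExp p s f := by
  simp only [sampleExp, mul_sum]
  exact sum_congr rfl fun W _ => by ring

theorem const (p c : ℝ) (s : Finset X) : sampleExp p s (fun _ => c) = c := by
  have h : ∀ W ∈ s.powerset, p ^ #W * (1 - p) ^ #(s \ W) * c =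
      p ^ #W * (1 - p) ^ (#s - #W) * c := fun W hW => by
    rw [card_sdiff_of_subset (mem_powerset.1 hW)]
  rw [sampleExp, sum_congr rfl h, ← sum_mul, sum_pow_mul_eq_add_pow]
  simp

/-- For antitone `f`, sampling once with probability `p + r` is at most as good as
sampling twice with probabilities `p` and `r`. -/
theorem add_le_union {p r : ℝ} (hp : 0 ≤ p) (hr : 0 ≤ r) (h : p + r ≤ 1) (s : Finset X)
    {f : Finset X → ℝ} (hf : Antitone f) :
    sampleExp (p + r) s f ≤ sampleExp p s (fun W => sampleExp r s (fun V => f (W ∪ V))) := by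
  induction s using Finset.induction_on generalizing f with
  | empty => simp [sampleExp]
  | insert a s ha ih =>
    have hg : Antitone fun W => f (insert a W) := fun V W hVW => hf (insert_subset_insert a hVW)
    have h1 := ih hf
    have h2 := ih hg
    simp only [insert_eq _ ha, add, mul_left, insert_union, union_insert, insert_idem]
    have h3 : sampleExp p s (fun W => sampleExp r s (fun V => f (insert a (W ∪ V)))) ≤
        sampleExp p s (fun W => sampleExp r s (fun V => f (W ∪ V))) :=
      mono hp (by linarith) s fun W => mono hr (by linarith) s fun V => hf (subset_insert _ _)
    have h4 := mul_le_mul_of_nonneg_left h1 (sub_nonneg.2 h)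
    have h5 := mul_le_mul_of_nonneg_left h2 (add_nonneg hp hr)
    -- Two samplings hit `a` with probability `p + r - p * r`; the deficit `p * r` is paid by `h3`.
    nlinarith [mul_nonneg (mul_nonneg hp hr) (sub_nonneg.2 h3)]

variable [Fintype X]

theorem one_univ (f : Finset X → ℝ) : sampleExp 1 univ f = f univ := by
  rw [sampleExp, sum_eq_single univ]
  · simp
  · intro W _ hW
    have : #(univ \ W) ≠ 0 := by
      rw [Ne, card_eq_zero, sdiff_eq_empty_iff_subset, univ_subset_iff]
      exact hW
    simp [zero_pow this]
  · simp

theorem markov {p : ℝ} (h0 : 0 ≤ p) (h1 : p ≤ 1) (f : Finset X → ℝ) (hf : ∀ W, 0 ≤ f W) (a : ℝ) :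
    a * sampleExp p univ (fun W => if a < f W then 1 else 0) ≤ sampleExp p univ f := by
  rw [← mul_left]
  refine mono h0 h1 _ fun W => ?_
  split_ifs with h
  · linarith
  · simpa using hf W

/-- Sum of the weights of all `W` with `W ∪ U = Z`. -/
theorem pow_mul_sum_union_eq (p : ℝ) {U Z : Finset X} (h : U ⊆ Z) :
    p ^ #U * ∑ W with W ∪ U = Z, p ^ #W * (1 - p) ^ #(univ \ W) =
      p ^ #Z * (1 - p) ^ #(univ \ Z) := by
  have h1 : ∑ W with W ∪ U = Z, p ^ #W * (1 - p) ^ #(univ \ W) =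
      ∑ B ∈ U.powerset, p ^ #(Z \ U) * (1 - p) ^ #(univ \ Z) * (p ^ #B * (1 - p) ^ (#U - #B)) := by
    -- The solutions `W` are `Z \ U ∪ B` with `B ⊆ U` arbitrary, so the factor over `U` sums to 1.
    refine (sum_bij' (fun B _ => Z \ U ∪ B) (fun W _ => W ∩ U) ?_ ?_ ?_ ?_ ?_).symm
    · intro B hB
      rw [mem_powerset] at hB
      simp only [mem_filter, mem_univ, true_and]
      grind
    · intro W _
      simp
    · intro B hB
      rw [mem_powerset] at hB
      grind
    · intro W hW
      simp only [mem_filter, mem_univ, true_and] at hW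
      grind
    · intro B hB
      rw [mem_powerset] at hB
      have e1 : #(Z \ U ∪ B) = #(Z \ U) + #B :=
        card_union_of_disjoint (disjoint_of_subset_right hB sdiff_disjoint)
      have e2 : univ \ (Z \ U ∪ B) = (univ \ Z) ∪ (U \ B) := by grind
      have e3 : #(univ \ (Z \ U ∪ B)) = #(univ \ Z) + (#U - #B) := by
        rw [e2, card_union_of_disjoint, card_sdiff_of_subset hB]
        exact disjoint_of_subset_right (sdiff_subset.trans h) sdiff_disjoint
      rw [e1, e3]
      ring
  rw [h1, ← mul_sum, sum_pow_mul_eq_add_pow, ← card_sdiff_add_card_eq_card h]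
  simp only [add_sub_cancel, one_pow]
  ring

end sampleExp

/-! ### The probability of containing no member of `H`. -/

/-- The indicator function of the event that a set contains no member of `H`. -/
noncomputable def missInd {X : Type*} (H : Finset (Finset X)) (W : Finset X) : ℝ :=
  open scoped Classical in if ∃ S ∈ H, S ⊆ W then 0 else 1

theorem missInd_le_one {X : Type*} (H : Finset (Finset X)) (W : Finset X) : missInd H W ≤ 1 := by
  unfold missInd
  split_ifs <;> norm_num

theorem missInd_antitone {X : Type*} (H : Finset (Finset X)) : Antitone (missInd H) := by
  intro V W h
  unfold missInd
  split_ifs with h1 h2 h2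
  · rfl
  · norm_num
  · obtain ⟨S, hS, hSV⟩ := h2
    exact absurd ⟨S, hS, hSV.trans h⟩ h1
  · rfl

theorem randomSubset_real_upSet {X : Type*} [Fintype X] [DecidableEq X] (H : Finset (Finset X))
    (p : ℝ) :
    (randomSubset X p).real (upSet H) =
      1 - sampleExp (Set.projIcc (0 : ℝ) 1 zero_le_one p : ℝ) univ (missInd H) := by
  classical
  set r := Set.projIcc (0 : ℝ) 1 zero_le_one p
  have h1 : upSet H = ⋃ W ∈ (univ.filter fun W : Finset X => ∃ S ∈ H, S ⊆ W), {(W : Set X)} := by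
    ext A
    simp only [upSet, Set.mem_ofPred_eq, mem_filter, mem_univ, true_and, Set.mem_iUnion,
      Set.mem_singleton_iff]
    constructor
    · rintro ⟨S, hS, hSA⟩
      exact ⟨A.toFinite.toFinset, ⟨S, hS, by simpa [← coe_subset] using hSA⟩, by simp⟩
    · rintro ⟨W, ⟨S, hS, hSW⟩, rfl⟩
      exact ⟨S, hS, by exact_mod_cast hSW⟩
  have h2 : ∀ W : Finset X, (ProbabilityTheory.setBernoulli Set.univ r).real {(W : Set X)} =
      (r : ℝ) ^ #W * (1 - r) ^ #(univ \ W) := by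
    intro W
    rw [ProbabilityTheory.setBernoulli_real_singleton r (Set.subset_univ _) Set.finite_univ,
      Set.ncard_coe_finset, ← coe_univ, ← coe_sdiff, Set.ncard_coe_finset]
  rw [randomSubset, h1, MeasureTheory.measureReal_biUnion_finset _ (by simp)]
  · have h3 := sampleExp.const (r : ℝ) 1 (univ : Finset X)
    refine Eq.trans ?_ (congrArg (· - sampleExp (r : ℝ) univ (missInd H)) h3)
    simp only [sampleExp]
    rw [← sum_sub_distrib, sum_filter,
      powerset_univ]
    refine sum_congr rfl fun W _ => ?_
    rw [missInd]
    split_ifs <;> simp [h2, r]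
  · intro V _ W _ hVW
    simpa [Function.onFun] using hVW

/-! ### Light fragments, heavy traces and their cost. -/

section Fragments

variable {X : Type*} [DecidableEq X]

/-- `F` covers `H`: every member of `H` contains a member of `F`. -/
def Covers (F H : Finset (Finset X)) : Prop :=
  ∀ S ∈ H, ∃ T ∈ F, T ⊆ S

/-- The traces of size more than `m` of `H` on a fixed member of `H` contained in `Z`
(no traces if there is no such member). -/
noncomputable def heavyTraces (H : Finset (Finset X)) (m : ℕ) (Z : Finset X) :
    Finset (Finset X) :=
  open scoped Classical in
  if h : ∃ S ∈ H, S ⊆ Z then {U ∈ H.image (· ∩ h.choose) | m < #U} else ∅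

theorem lt_card_of_mem_heavyTraces {H : Finset (Finset X)} {m : ℕ} {Z U : Finset X}
    (h : U ∈ heavyTraces H m Z) : m < #U := by
  unfold heavyTraces at h
  split_ifs at h
  · exact (mem_filter.1 h).2
  · simp at h

theorem subset_of_mem_heavyTraces {H : Finset (Finset X)} {m : ℕ} {Z U : Finset X}
    (h : U ∈ heavyTraces H m Z) : U ⊆ Z := by
  unfold heavyTraces at h
  split_ifs at h with h1
  · obtain ⟨S, _, rfl⟩ := mem_image.1 (mem_filter.1 h).1
    exact inter_subset_right.trans h1.choose_spec.2
  · simp at h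

/-- The sets of size at most `m` of the form `S \ W` with `S ∈ H`. -/
def lightFragments (H : Finset (Finset X)) (m : ℕ) (W : Finset X) : Finset (Finset X) :=
  {T ∈ H.image (· \ W) | #T ≤ m}

theorem vcDim_lightFragments_le (H : Finset (Finset X)) (m : ℕ) (W : Finset X) :
    (lightFragments H m W).vcDim ≤ H.vcDim := by
  refine Finset.sup_mono fun s hs => ?_
  rw [mem_shatterer] at hs ⊢
  have key : ∀ t ⊆ s, ∃ u ∈ H, s ∩ (u \ W) = t := by
    intro t ht
    obtain ⟨u, hu, hut⟩ := hs ht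
    obtain ⟨v, hv, rfl⟩ := mem_image.1 (mem_filter.1 hu).1
    exact ⟨v, hv, hut⟩
  -- The case `t = s` forces `s` to be disjoint from `W`, so removing `W` does not affect traces on
  -- `s`.
  obtain ⟨v, _, hvs⟩ := key s Subset.rfl
  intro t ht
  obtain ⟨u, hu, hut⟩ := key t ht
  exact ⟨u, hu, by grind⟩

/-- Take `R ⊆ W ∪ S` in `H` with `#(R \ W)` least. If this exceeds `m`, the member `Q` fixed for `W
∪ R` satisfies `Q \ W ⊆ R \ W`, with equality by minimality. So `U = S ∩ Q` contains `R \ W`, and `W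
∪ U = W ∪ R`. -/
theorem exists_lightFragment_or_heavyTrace {H : Finset (Finset X)} (m : ℕ) (W : Finset X)
    {S : Finset X} (hS : S ∈ H) :
    (∃ T ∈ lightFragments H m W, T ⊆ S) ∨ ∃ U ⊆ S, U ∈ heavyTraces H m (W ∪ U) := by
  obtain ⟨R, hR, hmin⟩ := exists_min_image {R ∈ H | R ⊆ W ∪ S} (fun R => #(R \ W))
    ⟨S, by simp [hS]⟩
  rw [mem_filter] at hR
  by_cases hm : #(R \ W) ≤ m
  · exact Or.inl ⟨R \ W, by simpa [lightFragments, hm] using ⟨R, hR.1, rfl⟩, by grind⟩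
  · right
    have hex : ∃ Q ∈ H, Q ⊆ W ∪ R := ⟨R, hR.1, subset_union_right⟩
    obtain ⟨hQ, hQR⟩ := hex.choose_spec
    set Q := hex.choose
    have hle := hmin Q (mem_filter.2 ⟨hQ, by grind⟩)
    have heq : Q \ W = R \ W := eq_of_subset_of_card_le (by grind) hle
    have hsub : R \ W ⊆ S ∩ Q := by grind
    have hZ : W ∪ S ∩ Q = W ∪ R := by grind
    refine ⟨S ∩ Q, inter_subset_left, ?_⟩
    rw [hZ, heavyTraces, dif_pos hex]
    exact mem_filter.2 ⟨mem_image_of_mem _ hS, (not_le.1 hm).trans_le (card_le_card hsub)⟩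

theorem missInd_union_le (H : Finset (Finset X)) (m : ℕ) (W V : Finset X) :
    missInd H (W ∪ V) ≤ missInd (lightFragments H m W) V := by
  unfold missInd
  split_ifs with h1 h2 h2
  · rfl
  · norm_num
  · obtain ⟨T, hT, hTV⟩ := h2
    obtain ⟨S, hS, rfl⟩ := mem_image.1 (mem_filter.1 hT).1
    exact absurd ⟨S, hS, by grind⟩ h1
  · rfl

theorem card_heavyTraces_le_two_pow {H : Finset (Finset X)} {k : ℕ} (hk : IsBoundedSystem k H)
    (m : ℕ) (Z : Finset X) : #(heavyTraces H m Z) ≤ 2 ^ k := by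
  unfold heavyTraces
  split_ifs with h
  · have hsub : {U ∈ H.image (· ∩ h.choose) | m < #U} ⊆ h.choose.powerset := by
      intro U hU
      obtain ⟨S, _, rfl⟩ := mem_image.1 (mem_filter.1 hU).1
      exact mem_powerset.2 inter_subset_right
    refine (card_le_card hsub).trans ?_
    rw [card_powerset]
    exact Nat.pow_le_pow_right two_pos (hk _ h.choose_spec.1)
  · simp

theorem sum_choose_le_succ_pow (n d : ℕ) : ∑ i ∈ range (d + 1), n.choose i ≤ (n + 1) ^ d := by
  rw [add_pow]
  refine sum_le_sum fun i hi => (Nat.choose_le_pow n i).trans ?_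
  rw [one_pow, mul_one]
  exact Nat.le_mul_of_pos_right _ (Nat.choose_pos (mem_range_succ_iff.1 hi))

theorem card_heavyTraces_le_succ_pow {H : Finset (Finset X)} {k d : ℕ}
    (hk : IsBoundedSystem k H) (hd : H.vcDim ≤ d) (m : ℕ) (Z : Finset X) :
    #(heavyTraces H m Z) ≤ (k + 1) ^ d := by
  unfold heavyTraces
  split_ifs with h
  · obtain ⟨hQ, -⟩ := h.choose_spec
    set Q := h.choose
    have hsub : (H.image (· ∩ Q)).shatterer ⊆ (range (d + 1)).biUnion fun i => Q.powersetCard i := by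
      intro s hs
      rw [mem_shatterer] at hs
      have hHs : H.Shatters s ∧ s ⊆ Q := by
        have key : ∀ t ⊆ s, ∃ u ∈ H, s ∩ (u ∩ Q) = t := by
          intro t ht
          obtain ⟨u, hu, hut⟩ := hs ht
          obtain ⟨v, hv, rfl⟩ := mem_image.1 hu
          exact ⟨v, hv, hut⟩
        obtain ⟨v, _, hvs⟩ := key s Subset.rfl
        refine ⟨fun t ht => ?_, by grind⟩
        obtain ⟨u, hu, hut⟩ := key t ht
        exact ⟨u, hu, by grind⟩
      rw [mem_biUnion]
      exact ⟨#s, mem_range_succ_iff.2 (hHs.1.card_le_vcDim.trans hd),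
        mem_powersetCard.2 ⟨hHs.2, rfl⟩⟩
    calc #{U ∈ H.image (· ∩ Q) | m < #U} ≤ #(H.image (· ∩ Q)) := card_filter_le _ _
      _ ≤ #(H.image (· ∩ Q)).shatterer := card_le_card_shatterer _
      _ ≤ ∑ i ∈ range (d + 1), #(Q.powersetCard i) := (card_le_card hsub).trans card_biUnion_le
      _ = ∑ i ∈ range (d + 1), (#Q).choose i := by simp
      _ ≤ (#Q + 1) ^ d := sum_choose_le_succ_pow _ _
      _ ≤ (k + 1) ^ d := Nat.pow_le_pow_left (Nat.succ_le_succ (hk _ hQ)) d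
  · simp

variable [Fintype X]

/-- The heavy traces left over by `W`. -/
noncomputable def heavyCover (H : Finset (Finset X)) (m : ℕ) (W : Finset X) :
    Finset (Finset X) :=
  {U | U ∈ heavyTraces H m (W ∪ U)}

/-- Pairs `(W, U)` are counted by `Z = W ∪ U`: a given `U` contributes `64 ^ (-#U)` times the weight
of `Z`, and at most `4 ^ (m + 1)` sets `U`, all of size above `m`, occur. -/
theorem sampleExp_heavyCover_le {H : Finset (Finset X)} {m : ℕ} {q : ℝ} (hq : 0 ≤ q)
    (hq1 : 64 * q ≤ 1) (hcard : ∀ Z, #(heavyTraces H m Z) ≤ 4 ^ (m + 1)) :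
    sampleExp (64 * q) univ (fun W => ∑ U ∈ heavyCover H m W, q ^ #U) ≤ (1 / 16) ^ (m + 1) := by
  set p := 64 * q with hp
  have hp0 : 0 ≤ p := by positivity
  set w : Finset X → ℝ := fun W => p ^ #W * (1 - p) ^ #(univ \ W) with hw
  have hw0 : ∀ W, 0 ≤ w W := fun W => by
    have := sub_nonneg.2 hq1
    positivity
  have h1 : sampleExp p univ (fun W => ∑ U ∈ heavyCover H m W, q ^ #U) =
      ∑ Z, ∑ U ∈ heavyTraces H m Z, q ^ #U * ∑ W with W ∪ U = Z, w W := by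
    have e1 : ∀ Z, ∑ U ∈ heavyTraces H m Z, q ^ #U * ∑ W with W ∪ U = Z, w W =
        ∑ U, ∑ W, if W ∪ U = Z then (if U ∈ heavyTraces H m Z then w W * q ^ #U else 0) else 0 := by
      intro Z
      rw [← univ_inter (heavyTraces H m Z), ← sum_ite_mem, univ_inter]
      refine sum_congr rfl fun U _ => ?_
      split_ifs
      · rw [mul_sum, sum_filter]
        exact sum_congr rfl fun W _ => by rw [mul_comm]
      · simp
    rw [sum_congr rfl fun Z _ => e1 Z, sum_comm]
    simp only [sampleExp, powerset_univ, heavyCover, mul_sum, sum_filter]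
    rw [sum_comm]
    refine sum_congr rfl fun U _ => ?_
    rw [sum_comm]
    refine sum_congr rfl fun W _ => ?_
    rw [sum_ite_eq, if_pos (mem_univ _)]
    split_ifs <;> simp [hw]
  have h2 : ∀ Z, ∀ U ∈ heavyTraces H m Z, q ^ #U * ∑ W with W ∪ U = Z, w W ≤
      (1 / 64) ^ (m + 1) * w Z := by
    intro Z U hU
    have e : q ^ #U = (1 / 64) ^ #U * p ^ #U := by
      rw [← mul_pow, hp]
      ring
    rw [e, mul_assoc, sampleExp.pow_mul_sum_union_eq p (subset_of_mem_heavyTraces hU)]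
    refine mul_le_mul_of_nonneg_right ?_ (hw0 Z)
    exact pow_le_pow_of_le_one (by norm_num) (by norm_num) (lt_card_of_mem_heavyTraces hU)
  have h3 : ∑ Z, w Z = 1 := by
    simpa [sampleExp, hw] using sampleExp.const p 1 (univ : Finset X)
  calc _ = _ := h1
    _ ≤ ∑ Z, (1 / 16) ^ (m + 1) * w Z := by
        refine sum_le_sum fun Z _ => ?_
        calc _ ≤ #(heavyTraces H m Z) • ((1 / 64) ^ (m + 1) * w Z) :=
              sum_le_card_nsmul _ _ _ (h2 Z)
          _ ≤ (4 ^ (m + 1) : ℕ) • ((1 / 64 : ℝ) ^ (m + 1) * w Z) :=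
              nsmul_le_nsmul_left (mul_nonneg (by positivity) (hw0 Z)) (hcard Z)
          _ = (1 / 16) ^ (m + 1) * w Z := by
              rw [nsmul_eq_mul, ← mul_assoc, Nat.cast_pow, ← mul_pow]
              norm_num
    _ = (1 / 16) ^ (m + 1) := by rw [← mul_sum, h3, mul_one]

end Fragments

/-! ### Iterating the size reduction. -/

section Iteration

variable {X : Type*} [DecidableEq X] [Fintype X]

/-- The cost that every cover of a `k`-bounded family is required to exceed. -/
noncomputable def coverThreshold (k : ℕ) : ℝ := 2 / 3 - 1 / 3 * (1 / 16) ^ k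

/-- The slack covers the Markov bound: four times the expected cost of the heavy cover. -/
theorem coverThreshold_add_le {m k : ℕ} (h : m < k) :
    coverThreshold m + 4 * (1 / 16) ^ (m + 1) ≤ coverThreshold k := by
  have h1 : (1 / 16 : ℝ) ^ k ≤ (1 / 16) ^ (m + 1) :=
    pow_le_pow_of_le_one (by norm_num) (by norm_num) h
  have h2 : (0 : ℝ) < (1 / 16) ^ m := by positivity
  unfold coverThreshold
  rw [pow_succ] at *
  linarith

variable (X) in
/-- Every `k`-bounded family of VC-dimension at most `d` that has no cheap cover is missed by
a random set of density at least `64 * N * q` with probability at most `4 ^ j * (1 / 2) ^ N`. -/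
def MissBound (q : ℝ) (d k j : ℕ) : Prop :=
  ∀ (N : ℕ) (ρ : ℝ) (H : Finset (Finset X)), N * (64 * q) ≤ ρ → ρ ≤ 1 → IsBoundedSystem k H →
    H.vcDim ≤ d → (∀ F, Covers F H → coverThreshold k < ∑ T ∈ F, q ^ #T) →
      sampleExp ρ univ (missInd H) ≤ 4 ^ j * (1 / 2) ^ N

theorem Covers.union_heavyCover {F H : Finset (Finset X)} {m : ℕ} {W : Finset X}
    (h : Covers F (lightFragments H m W)) : Covers (F ∪ heavyCover H m W) H := by
  intro S hS
  obtain ⟨T, hT, hTS⟩ | ⟨U, hUS, hU⟩ := exists_lightFragment_or_heavyTrace m W hS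
  · obtain ⟨R, hR, hRT⟩ := h T hT
    exact ⟨R, mem_union_left _ hR, hRT.trans hTS⟩
  · exact ⟨U, mem_union_right _ (by simpa [heavyCover] using hU), hUS⟩

theorem MissBound.zero (q : ℝ) (d j : ℕ) : MissBound X q d 0 j := by
  intro N ρ H hρ hρ1 hb _ hF
  have hne : H.Nonempty := by
    rw [nonempty_iff_ne_empty]
    rintro rfl
    have := hF ∅ (by simp [Covers])
    norm_num [coverThreshold] at this
  obtain ⟨S, hS⟩ := hne
  have hS0 : S = ∅ := by simpa using hb S hS
  subst hS0
  have h0 : missInd H = fun _ => 0 := by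
    funext W
    exact if_pos ⟨∅, hS, empty_subset W⟩
  rw [h0, sampleExp.const]
  positivity

theorem MissBound.mono {q : ℝ} {d k i j : ℕ} (hij : i ≤ j) (h : MissBound X q d k i) :
    MissBound X q d k j := by
  intro N ρ H h1 h2 h3 h4 h5
  refine (h N ρ H h1 h2 h3 h4 h5).trans ?_
  gcongr
  norm_num

/-- Induction on the number of slices: a good slice passes to the fragments, a bad one (probability
at most 1/4) retries `H`. The bound solves `b (j+1) (N+1) = b j N + b (j+1) N / 4`. -/
theorem MissBound.succ {q : ℝ} (hq : 0 ≤ q) {d k m j : ℕ} (hmk : m < k)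
    (hcount : 2 ^ k ≤ 4 ^ (m + 1) ∨ (k + 1) ^ d ≤ 4 ^ (m + 1)) (h : MissBound X q d m j) :
    MissBound X q d k (j + 1) := by
  intro N
  induction N with
  | zero =>
    intro ρ H hρ hρ1 _ _ _
    refine (sampleExp.mono (by simpa using hρ) hρ1 univ (missInd_le_one H)).trans ?_
    rw [sampleExp.const, pow_zero, mul_one]
    exact one_le_pow₀ (by norm_num)
  | succ N ih =>
    intro ρ H hρ hρ1 hb hd hF
    push_cast at hρ
    have hNp : (N : ℝ) * (64 * q) ≤ ρ - 64 * q := by linarith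
    have hr0 : 0 ≤ ρ - 64 * q := le_trans (by positivity) hNp
    have hp0 : 0 ≤ 64 * q := by positivity
    have hp1 : 64 * q ≤ 1 := by linarith
    have hr1 : ρ - 64 * q ≤ 1 := by linarith
    have hcard : ∀ Z, #(heavyTraces H m Z) ≤ 4 ^ (m + 1) := fun Z =>
      hcount.elim (card_heavyTraces_le_two_pow hb m Z).trans
        (card_heavyTraces_le_succ_pow hb hd m Z).trans
    set cost : Finset X → ℝ := fun W => ∑ U ∈ heavyCover H m W, q ^ #U with hcost
    have hcost0 : ∀ W, 0 ≤ cost W := fun W => sum_nonneg fun U _ => by positivity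
    set a : ℝ := 4 * (1 / 16) ^ (m + 1) with ha
    set bad := sampleExp (64 * q) univ (fun W => if a < cost W then (1 : ℝ) else 0) with hbad
    have hbad4 : bad ≤ 1 / 4 := by
      have h1 := sampleExp.markov hp0 hp1 cost hcost0 a
      have h2 := sampleExp_heavyCover_le hq hp1 hcard
      have h3 : (0 : ℝ) < (1 / 16) ^ (m + 1) := by positivity
      have h4 : a * bad ≤ a * (1 / 4) := by
        refine (h1.trans h2).trans_eq ?_
        rw [ha]
        ring
      exact le_of_mul_le_mul_left h4 (by positivity)
    have hpt : ∀ W, sampleExp (ρ - 64 * q) univ (fun V => missInd H (W ∪ V)) ≤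
        4 ^ j * (1 / 2) ^ N +
          4 ^ (j + 1) * (1 / 2) ^ N * (if a < cost W then (1 : ℝ) else 0) := by
      intro W
      split_ifs with hW
      · have h1 : sampleExp (ρ - 64 * q) univ (fun V => missInd H (W ∪ V)) ≤
            sampleExp (ρ - 64 * q) univ (missInd H) :=
          sampleExp.mono hr0 hr1 _ fun V => missInd_antitone H subset_union_right
        have h2 := ih (ρ - 64 * q) H hNp hr1 hb hd hF
        have h3 : (0 : ℝ) ≤ 4 ^ j * (1 / 2) ^ N := by positivity
        linarith
      · have h1 : sampleExp (ρ - 64 * q) univ (fun V => missInd H (W ∪ V)) ≤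
            sampleExp (ρ - 64 * q) univ (missInd (lightFragments H m W)) :=
          sampleExp.mono hr0 hr1 _ fun V => missInd_union_le H m W V
        have h2 := h N (ρ - 64 * q) (lightFragments H m W) hNp hr1
          (fun T hT => (mem_filter.1 hT).2) ((vcDim_lightFragments_le H m W).trans hd) ?_
        · linarith
        · intro F hFc
          have h3 := hF _ hFc.union_heavyCover
          have h4 : ∑ T ∈ F ∪ heavyCover H m W, q ^ #T ≤ ∑ T ∈ F, q ^ #T + cost W := by
            rw [← sum_union_inter]
            exact le_add_of_nonneg_right (sum_nonneg fun U _ => by positivity)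
          have h5 := coverThreshold_add_le hmk
          linarith [not_lt.1 hW]
    have hsplit := sampleExp.add_le_union hp0 hr0 (by linarith) univ (missInd_antitone H)
    rw [add_sub_cancel] at hsplit
    refine hsplit.trans ((sampleExp.mono hp0 hp1 univ hpt).trans ?_)
    rw [sampleExp.add, sampleExp.const, sampleExp.mul_left, ← hbad]
    have h1 : (0 : ℝ) ≤ 4 ^ (j + 1) * (1 / 2) ^ N := by positivity
    have h2 := mul_le_mul_of_nonneg_left hbad4 h1
    refine (add_le_add_right h2 _).trans_eq ?_
    ring

theorem MissBound.of_lt_two_pow {q : ℝ} (hq : 0 ≤ q) (d : ℕ) {k j : ℕ} (h : k < 2 ^ j) :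
    MissBound X q d k j := by
  induction j generalizing k with
  | zero =>
    obtain rfl : k = 0 := by simpa using h
    exact MissBound.zero q d 0
  | succ j ih =>
    obtain rfl | hk := k.eq_zero_or_pos
    · exact MissBound.zero q d _
    -- With `m = k / 2` the trivial count of `2 ^ k` traces suffices.
    · refine MissBound.succ hq (Nat.div_lt_self hk one_lt_two) (Or.inl ?_) (ih (k := k / 2) ?_)
      · rw [show 4 = 2 ^ 2 by norm_num, ← pow_mul]
        exact Nat.pow_le_pow_right two_pos (by omega)
      · rw [pow_succ] at h
        omega

theorem logStar_of_one_lt {x : ℝ} (hx : 1 < x) : logStar x = logStar (Real.logb 2 x) + 1 := by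
  have hne := logStar_set_nonempty (Real.logb 2 x)
  unfold logStar
  apply le_antisymm
  · apply Nat.sInf_le
    have := Nat.sInf_mem hne
    simpa [Function.iterate_succ_apply] using this
  · refine le_csInf (logStar_set_nonempty x) fun k hk => ?_
    cases k with
    | zero => exact absurd hk (by simpa using hx)
    | succ k =>
      refine Nat.succ_le_succ (Nat.sInf_le ?_)
      simpa [Function.iterate_succ_apply] using hk

theorem logb_two_natCast_le (n : ℕ) : Real.logb 2 n ≤ n := by
  obtain rfl | hn := n.eq_zero_or_pos
  · simp
  · rw [Real.logb_le_iff_le_rpow one_lt_two (by exact_mod_cast hn), Real.rpow_natCast]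
    exact_mod_cast Nat.lt_two_pow_self.le

/-- Replacing `x` by `y = log x` costs one level, since Sauer-Shelah gives at most `(k + 1) ^ d`
traces and `d * log (k + 1) ≤ 16 d² y`. Stopping at `x ≤ 2` keeps `y ≥ 1` and leaves `k ≤ 32 d²` to
halving. -/
theorem MissBound.of_le_mul {q : ℝ} (hq : 0 ≤ q) {d k j : ℕ} (hd : 1 ≤ d)
    (hj : 32 * d ^ 2 < 2 ^ j) {x : ℝ} (hk : (k : ℝ) ≤ 16 * d ^ 2 * x) :
    MissBound X q d k (logStar x + j) := by
  have hd1 : (1 : ℝ) ≤ d := by exact_mod_cast hd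
  induction hn : logStar x generalizing k x with
  | zero =>
    have hx : x ≤ 2 := by
      by_contra! hx
      rw [logStar_of_one_lt (by linarith)] at hn
      omega
    refine (MissBound.of_lt_two_pow hq d (lt_of_le_of_lt ?_ hj)).mono (Nat.le_add_left j 0)
    have : (k : ℝ) ≤ 32 * d ^ 2 := by nlinarith [sq_nonneg (d : ℝ)]
    exact_mod_cast this
  | succ n ih =>
    by_cases hx : x ≤ 2
    · refine (MissBound.of_lt_two_pow hq d (lt_of_le_of_lt ?_ hj)).mono (Nat.le_add_left j _)
      have : (k : ℝ) ≤ 32 * d ^ 2 := by nlinarith [sq_nonneg (d : ℝ)]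
      exact_mod_cast this
    push Not at hx
    rw [logStar_of_one_lt (by linarith)] at hn
    set y := Real.logb 2 x with hy
    have hy1 : 1 ≤ y := by
      rw [hy, Real.le_logb_iff_rpow_le one_lt_two (by linarith), Real.rpow_one]
      exact hx.le
    have hy0 : 0 ≤ 16 * (d : ℝ) ^ 2 * y := by positivity
    set m := ⌊16 * (d : ℝ) ^ 2 * y⌋₊ with hm
    by_cases hkm : k ≤ m
    · refine (ih (x := y) ?_ (by omega)).mono (by omega)
      exact (Nat.cast_le.2 hkm).trans (Nat.floor_le hy0)
    have hlog : Real.logb 2 (k + 1) ≤ 16 * d * y := by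
      have h1 : (k : ℝ) + 1 ≤ 32 * (d ^ 2 * x) := by nlinarith
      have h2 : Real.logb 2 (32 * ((d : ℝ) ^ 2 * x)) = 5 + 2 * Real.logb 2 d + y := by
        rw [Real.logb_mul (by norm_num) (by positivity), Real.logb_mul (by positivity) (by linarith),
          Real.logb_pow, show (32 : ℝ) = 2 ^ 5 by norm_num, Real.logb_pow,
          Real.logb_self_eq_one one_lt_two]
        push_cast
        ring
      have h3 := (Real.logb_le_logb_of_le one_lt_two (by positivity) h1).trans_eq h2
      have h4 := logb_two_natCast_le d
      nlinarith
    have hpow : (k + 1) ^ d ≤ 4 ^ (m + 1) := by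
      have h1 : Real.logb 2 (((k : ℝ) + 1) ^ d) ≤ (m + 1 : ℕ) := by
        rw [Real.logb_pow]
        have h2 := Nat.lt_floor_add_one (16 * (d : ℝ) ^ 2 * y)
        rw [← hm] at h2
        push_cast
        nlinarith
      rw [Real.logb_le_iff_le_rpow one_lt_two (by positivity), Real.rpow_natCast] at h1
      have h3 : (k + 1) ^ d ≤ 2 ^ (m + 1) := by exact_mod_cast h1
      exact h3.trans (Nat.pow_le_pow_left (by norm_num) _)
    have h := MissBound.succ hq (not_le.1 hkm) (Or.inr hpow)
      (ih (k := m) (x := y) (Nat.floor_le hy0) (by omega))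
    exact h.mono (by omega)

end Iteration

/-! ### Choice of constants. -/

theorem mainTheorem3 :
    ∃ A : ℝ, 0 < A ∧
      ∀ (X : Type*) [Fintype X] [DecidableEq X] (H : Finset (Finset X)) (l d : ℕ) (q : ℝ),
        IsBoundedSystem l H → 1 ≤ d → H.vcDim ≤ d → 0 ≤ q → q ≤ 1 →
          (∃ F : Finset (Finset X),
              (∀ S ∈ H, (S : Set X) ∈ upSet F) ∧ ∑ T ∈ F, q ^ T.card ≤ 2 / 3) ∨
          (∀ ε : ℝ, 0 < ε → ε ≤ 1 / 2 →
              1 - ε <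
                (randomSubset X (A * q * (Real.logb 2 ((d : ℝ) / ε) + (logStar (l : ℝ) : ℝ)))).real
                  (upSet H)) := by
  refine ⟨1280, by norm_num, fun X _ _ H l d q hb hd hvc hq _ => or_iff_not_imp_left.2 ?_⟩
  intro hF ε hε hε2
  push Not at hF
  have hcov : ∀ F, Covers F H → 2 / 3 < ∑ T ∈ F, q ^ #T := fun F hFH =>
    hF F fun S hS => by
      obtain ⟨T, hT, hTS⟩ := hFH S hS
      exact ⟨T, hT, by exact_mod_cast hTS⟩
  have hne : H.Nonempty := by
    rw [nonempty_iff_ne_empty]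
    rintro rfl
    have := hcov ∅ (by simp [Covers])
    norm_num at this
  rw [randomSubset_real_upSet]
  refine sub_lt_sub_left ?_ 1
  have hd1 : (1 : ℝ) ≤ d := by exact_mod_cast hd
  set s : ℝ := (logStar (l : ℝ) : ℝ) with hs
  have hs0 : 0 ≤ s := Nat.cast_nonneg _
  set P := 1280 * q * (Real.logb 2 ((d : ℝ) / ε) + s) with hP
  obtain hP1 | hP1 := le_total 1 P
  -- At density 1 the random set is everything, and `H` is nonempty.
  · rw [Set.projIcc_of_right_le _ hP1, sampleExp.one_univ]
    obtain ⟨S, hS⟩ := hne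
    rw [missInd, if_pos ⟨S, hS, subset_univ S⟩]
    exact hε
  have hlogd0 : 0 ≤ Real.logb 2 d := Real.logb_nonneg one_lt_two hd1
  have hlogε : 1 ≤ Real.logb 2 (1 / ε) := by
    rw [Real.le_logb_iff_rpow_le one_lt_two (by positivity), Real.rpow_one, le_div_iff₀ hε]
    linarith
  have hlogdiv : Real.logb 2 ((d : ℝ) / ε) = Real.logb 2 d + Real.logb 2 (1 / ε) := by
    rw [← Real.logb_mul (by positivity) (by positivity), mul_one_div]
  have hP0 : 0 ≤ P := by
    rw [hP, hlogdiv]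
    positivity
  rw [Set.projIcc_of_mem _ ⟨hP0, hP1⟩]
  set e := Nat.log 2 d + 1 with he
  set t := ⌊Real.logb 2 (1 / ε)⌋₊ + 1 with ht
  set j := logStar (l : ℝ) + (5 + 2 * e) with hj
  have hde : 32 * d ^ 2 < 2 ^ (5 + 2 * e) := by
    have h1 : d < 2 ^ e := Nat.lt_pow_succ_log_self one_lt_two d
    have h2 : d ^ 2 < (2 ^ e) ^ 2 := Nat.pow_lt_pow_left h1 two_ne_zero
    rw [pow_add, mul_comm 2 e, pow_mul]
    omega
  have hle : (e : ℝ) ≤ Real.logb 2 d + 1 := by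
    rw [he, Nat.cast_add, Nat.cast_one]
    exact add_le_add_left (mod_cast Real.natLog_le_logb d 2) 1
  have hmiss := MissBound.of_le_mul (X := X) hq (k := l) (x := l) hd hde
    (le_mul_of_one_le_left (Nat.cast_nonneg l) (by nlinarith))
  have hthr : ∀ F, Covers F H → coverThreshold l < ∑ T ∈ F, q ^ #T := fun F hFH => by
    refine lt_of_le_of_lt ?_ (hcov F hFH)
    have : (0 : ℝ) < (1 / 16) ^ l := by positivity
    unfold coverThreshold
    linarith
  -- Of the slices, `2 * j` cancel the factor `4 ^ j` and `t` bring the bound below `ε`. Here `1280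
  -- = 20 * 64`, and `log (1/ε) ≥ 1` absorbs the additive constants.
  have hN : ((2 * j + t : ℕ) : ℝ) * (64 * q) ≤ P := by
    have h1 : (t : ℝ) ≤ Real.logb 2 (1 / ε) + 1 := by
      rw [ht, Nat.cast_add, Nat.cast_one]
      have := Nat.floor_le (zero_le_one.trans hlogε)
      linarith
    have h2 : ((2 * j + t : ℕ) : ℝ) ≤ 20 * (Real.logb 2 ((d : ℝ) / ε) + s) := by
      rw [hlogdiv, hj]
      push_cast
      linarith
    have h3 := mul_le_mul_of_nonneg_right h2 (by positivity : 0 ≤ 64 * q)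
    linarith
  refine (hmiss (2 * j + t) P H hN hP1 hb hvc hthr).trans_lt ?_
  have h1 : (4 : ℝ) ^ j * (1 / 2) ^ (2 * j + t) = (1 / 2) ^ t := by
    rw [pow_add (1 / 2 : ℝ), pow_mul, ← mul_assoc, ← mul_pow]
    norm_num
  have h2 : 1 / ε < 2 ^ t := by
    have h3 := Nat.lt_floor_add_one (Real.logb 2 (1 / ε))
    rw [Real.logb_lt_iff_lt_rpow one_lt_two (by positivity)] at h3
    rw [ht, ← Real.rpow_natCast, Nat.cast_add, Nat.cast_one]
    exact h3
  rw [h1, one_div_pow, one_div_lt (by positivity) hε]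
  exact h2
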